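/- **FirstDiff.** Balls are placed one after another into $n$ bins. Every ball makes at most $k$ probes, each to a bin chosen uniformly at random, independently of all other probes (with replacement). It stops probing as soon as a probed bin is empty or has a load different from that of the bins it probed before, and is then placed into a least loaded one of the bins it has probed (ties are broken arbitrarily, possibly depending on the past). If all $k$ probed bins have the same positive load, it is placed into the bin probed last. FirstDiff$[d]$ is this algorithm with a maximum number $k=2^{\Theta(d)}>2$ of probes per ball. **Theorem 4.** There are absolute constants $C,K,r>0$ such that for all $c_1,c_2>0$ there are $a,b>0$ with the following property. Let $k>2$ be an integer and $d$ a real number with $2^{c_1 d}\le k\le 2^{c_2 d}$. Then $a\,d\le \ln k\le b\,d$, that is, $\ln k=\Theta(d)$, and for all integers $n\ge 2$ and $m\ge n$, if $m$ balls are placed into $n$ bins by FirstDiff$[d]$ with at most $k$ probes per ball, then with probability at least $1-K n^{-r}$ the maximum load of any bin is at least $$\frac mn+\frac{\ln\ln n}{\ln k}-C .$$ In short: with high probability the maximum load is at least $\frac mn+\frac{\ln\ln n}{\Theta(d)}-\Theta(1)$. -/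

import Mathlib

namespace BallsBins

/-- The potential probes of one ball: probe number `j` inspects the bin `p j`.
At most `k` probes may be made into the `n` bins. -/
abbrev Probes (n k : ℕ) : Type := Fin k → Fin n

/-- The condition on which the probing of a ball is broken off at probe `j`: the probed bin is
empty, or its load differs from the load of a bin probed before. -/
def Stops {n k : ℕ} (load : Fin n → ℕ) (p : Probes n k) (j : Fin k) : Prop :=
  load (p j) = 0 ∨ ∃ i, i < j ∧ load (p i) ≠ load (p j)

/-- `j` is the last probe that is actually made: no earlier probe broke off the probing, and either
probe `j` does or the budget of `k` probes is used up. -/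
def IsLastProbe {n k : ℕ} (load : Fin n → ℕ) (p : Probes n k) (j : Fin k) : Prop :=
  (∀ i, i < j → ¬ Stops load p i) ∧ (Stops load p j ∨ (j : ℕ) + 1 = k)

/-- `b` is a bin into which FirstDiff with at most `k` probes may place a ball that meets the loads
`load` and has the probes `p`.  If the probing was broken off, then `b` is a least loaded one among
the probed bins (several choices are possible: ties are broken arbitrarily; an empty bin that was
found is the only choice).  If it was not, all `k` probed bins are equally loaded, and `b` is the
bin probed last. -/
def IsPlacement {n k : ℕ} (load : Fin n → ℕ) (p : Probes n k) (b : Fin n) : Prop :=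
  ∃ j, IsLastProbe load p j ∧
    ((Stops load p j ∧ (∃ i, i ≤ j ∧ p i = b) ∧ ∀ i, i ≤ j → load b ≤ load (p i)) ∨
      (¬ Stops load p j ∧ b = p j))

/-- A sequential placement rule: the bin of ball number `t` (counted from `0`) as a function of the
probes of the earlier balls and of the probes of this ball. -/
abbrev Rule (n k : ℕ) : Type := (t : ℕ) → (Fin t → Probes n k) → Probes n k → Fin n

/-- The load vector after `t` balls with probes `ω` have been placed by the rule `A`. -/
def loads {n k : ℕ} (A : Rule n k) : (t : ℕ) → (Fin t → Probes n k) → Fin n → ℕ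
  | 0, _ => fun _ => 0
  | t + 1, ω => fun b =>
      loads A t (Fin.init ω) b + if b = A t (Fin.init ω) (ω (Fin.last t)) then 1 else 0

/-- `A` is an implementation of FirstDiff with at most `k` probes per ball.  Implementations differ
only in how they break ties, and they may do so in dependence on the whole past. -/
def IsFirstDiff {n k : ℕ} (A : Rule n k) : Prop :=
  ∀ (t : ℕ) (ω : Fin t → Probes n k) (p : Probes n k), IsPlacement (loads A t ω) p (A t ω p)

/-- The maximum load of a bin after `m` balls. -/
def maxLoad {n k : ℕ} (A : Rule n k) (m : ℕ) (ω : Fin m → Probes n k) : ℕ :=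
  Finset.univ.sup (loads A m ω)

/-- The law of the probes of `m` balls: all `m * k` potential probes are independent and uniformly
distributed on the `n` bins, that is, all probe sequences are equally likely. -/
noncomputable def probeLaw (n k m : ℕ) : MeasureTheory.Measure (Fin m → Probes n k) :=
  ProbabilityTheory.uniformOn Set.univ

end BallsBins

/-! Only the last n balls matter. By averaging over the first m - n, some level j above the integer
average is reached by at least n / 2^(j+1) bins (`exists_le_numAtLeast`). From there a layered
induction climbs. If n / 2^e bins reach level h, then either many of them already exceed h, or at
least n / 2^(e+1) sit exactly at h. In the latter case a ball has all k potential probes there with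
probability at least 2^(-k(e+1)), and is then placed at level h whatever the tie-breaking
(`IsFirstDiff.load_eq`).

A phase therefore multiplies the exponent e by about k (`condMean_phase_le`), so about log_k(log n /
(j+11)) levels are gained before n / 2^e drops to √n. A large j costs only log_k(j+11) levels, which
j itself repays (`exists_layers`). Each phase fails with probability at most exp(-√n). -/

open Finset

namespace BallsBins

/-! ### Averages over probe histories -/

variable {n k : ℕ}

/-- The expectation of `F` after `s` more balls, given the probes `ω` of the first `t` balls. -/
noncomputable def condMean (F : (t : ℕ) → (Fin t → Probes n k) → ℝ) :
    ℕ → (t : ℕ) → (Fin t → Probes n k) → ℝ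
  | 0, t, ω => F t ω
  | s + 1, t, ω =>
      (∑ p : Probes n k, condMean F s (t + 1) (Fin.snoc ω p)) / Fintype.card (Probes n k)

/-- The mean of `F` over all histories of length `t`. -/
noncomputable def mean (F : (t : ℕ) → (Fin t → Probes n k) → ℝ) (t : ℕ) : ℝ :=
  (∑ ω : Fin t → Probes n k, F t ω) / (Fintype.card (Probes n k) : ℝ) ^ t

theorem condMean_add (F : (t : ℕ) → (Fin t → Probes n k) → ℝ) (s s' t : ℕ)
    (ω : Fin t → Probes n k) :
    condMean F (s + s') t ω = condMean (condMean F s') s t ω := by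
  induction s generalizing t ω with
  | zero => simp [condMean]
  | succ s ih =>
    rw [Nat.add_right_comm]
    simp only [condMean, ih]

theorem condMean_mono {F G : (t : ℕ) → (Fin t → Probes n k) → ℝ} (h : ∀ t ω, F t ω ≤ G t ω)
    (s t : ℕ) (ω : Fin t → Probes n k) : condMean F s t ω ≤ condMean G s t ω := by
  induction s generalizing t ω with
  | zero => exact h t ω
  | succ s ih =>
    simp only [condMean]
    gcongr with p
    exact ih _ _

theorem condMean_add_const [NeZero n] (F : (t : ℕ) → (Fin t → Probes n k) → ℝ) (c : ℝ)
    (s t : ℕ) (ω : Fin t → Probes n k) :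
    condMean (fun t ω => F t ω + c) s t ω = condMean F s t ω + c := by
  induction s generalizing t ω with
  | zero => rfl
  | succ s ih =>
    simp only [condMean, ih, sum_add_distrib, add_div, sum_const, card_univ, nsmul_eq_mul]
    rw [mul_div_cancel_left₀ c (by exact_mod_cast Fintype.card_ne_zero)]

theorem condMean_le_one [NeZero n] {F : (t : ℕ) → (Fin t → Probes n k) → ℝ}
    (h : ∀ t ω, F t ω ≤ 1) (s t : ℕ) (ω : Fin t → Probes n k) : condMean F s t ω ≤ 1 := by
  induction s generalizing t ω with
  | zero => exact h t ω
  | succ s ih =>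
    have hP : (0 : ℝ) < Fintype.card (Probes n k) := by exact_mod_cast Fintype.card_pos
    rw [condMean, div_le_one hP, ← card_univ, ← nsmul_one, ← sum_const]
    exact sum_le_sum fun p _ => ih _ _

theorem mean_succ (F : (t : ℕ) → (Fin t → Probes n k) → ℝ) (t : ℕ) :
    mean F (t + 1) = mean (condMean F 1) t := by
  have h : ∑ ω : Fin (t + 1) → Probes n k, F (t + 1) ω
      = ∑ ω : Fin t → Probes n k, ∑ p : Probes n k, F (t + 1) (Fin.snoc ω p) := by
    rw [← (Fin.snocEquiv fun _ : Fin (t + 1) => Probes n k).sum_comp, Fintype.sum_prod_type,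
      sum_comm]
    rfl
  simp only [mean, condMean, h, ← sum_div]
  rw [div_div, pow_succ']

theorem mean_add (F : (t : ℕ) → (Fin t → Probes n k) → ℝ) (t s : ℕ) :
    mean F (t + s) = mean (condMean F s) t := by
  induction s generalizing F with
  | zero => rfl
  | succ s ih =>
    rw [← Nat.add_assoc, mean_succ, ih]
    congr 1
    funext t ω
    rw [← condMean_add]

theorem mean_le [NeZero n] {F : (t : ℕ) → (Fin t → Probes n k) → ℝ} {t : ℕ} {c : ℝ}
    (h : ∀ ω, F t ω ≤ c) : mean F t ≤ c := by
  have hP : (0 : ℝ) < Fintype.card (Probes n k) := by exact_mod_cast Fintype.card_pos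
  rw [mean, div_le_iff₀ (by positivity)]
  calc ∑ ω, F t ω ≤ ∑ _ω : Fin t → Probes n k, c := sum_le_sum fun ω _ => h ω
    _ = c * (Fintype.card (Probes n k) : ℝ) ^ t := by
      rw [sum_const, card_univ, nsmul_eq_mul, mul_comm, Fintype.card_fun, Fintype.card_fin]
      push_cast
      rfl

theorem probeLaw_real_add_mean [NeZero n] (A : Rule n k) (m : ℕ) (x : ℝ) :
    (probeLaw n k m).real {ω | x ≤ (maxLoad A m ω : ℝ)}
      + mean (fun t ω => if (maxLoad A t ω : ℝ) < x then 1 else 0) m = 1 := by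
  classical
  set S : Set (Fin m → Probes n k) := {ω | x ≤ (maxLoad A m ω : ℝ)} with hSdef
  have hS : MeasureTheory.Measure.count S
      = ((#{ω : Fin m → Probes n k | x ≤ (maxLoad A m ω : ℝ)} : ℕ) : ENNReal) := by
    rw [← MeasureTheory.Measure.count_apply_finset]
    simp [hSdef]
  have hP : (Fintype.card (Fin m → Probes n k) : ℝ) ≠ 0 := by
    exact_mod_cast Fintype.card_ne_zero
  have hsum := card_filter_add_card_filter_not (s := (univ : Finset (Fin m → Probes n k)))
    (fun ω => x ≤ (maxLoad A m ω : ℝ))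
  simp only [not_le, card_univ] at hsum
  rw [MeasureTheory.measureReal_def, probeLaw, ProbabilityTheory.uniformOn_univ, hS,
    ENNReal.toReal_div, ENNReal.toReal_natCast, ENNReal.toReal_natCast, mean, sum_boole,
    ← Nat.cast_pow, show Fintype.card (Probes n k) ^ m = Fintype.card (Fin m → Probes n k) by
      rw [Fintype.card_fun (α := Fin m), Fintype.card_fin], ← add_div, div_eq_one_iff_eq hP]
  exact_mod_cast hsum

/-! ### Level counts and their growth -/

variable (A : Rule n k)

/-- The number of bins of load at least `h`. -/
def numAtLeast (h t : ℕ) (ω : Fin t → Probes n k) : ℕ := #{b | h ≤ loads A t ω b}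

/-- The indicator of the event that fewer than `N` bins have load at least `h`. -/
noncomputable def fewAtLeast (h : ℕ) (N : ℝ) (t : ℕ) (ω : Fin t → Probes n k) : ℝ :=
  if (numAtLeast A h t ω : ℝ) < N then 1 else 0

theorem fewAtLeast_le_one (h : ℕ) (N : ℝ) (t : ℕ) (ω : Fin t → Probes n k) :
    fewAtLeast A h N t ω ≤ 1 := by
  rw [fewAtLeast]
  split_ifs <;> norm_num

theorem loads_snoc (t : ℕ) (ω : Fin t → Probes n k) (p : Probes n k) (b : Fin n) :
    loads A (t + 1) (Fin.snoc ω p : Fin (t + 1) → Probes n k) b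
      = loads A t ω b + if b = A t ω p then 1 else 0 := by
  simp [loads]

theorem sum_loads (t : ℕ) (ω : Fin t → Probes n k) : ∑ b, loads A t ω b = t := by
  induction t with
  | zero => simp [loads]
  | succ t ih => simp [loads, sum_add_distrib, ih]

theorem numAtLeast_snoc_ge (h t : ℕ) (ω : Fin t → Probes n k) (p : Probes n k) :
    numAtLeast A h t ω ≤ numAtLeast A h (t + 1) (Fin.snoc ω p) := by
  refine card_le_card fun b => ?_
  simp only [mem_filter, mem_univ, true_and, loads_snoc]
  omega

theorem numAtLeast_snoc_of_load_eq {h t : ℕ} {ω : Fin t → Probes n k} {p : Probes n k}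
    (hA : loads A t ω (A t ω p) = h) :
    numAtLeast A (h + 1) t ω + 1 ≤ numAtLeast A (h + 1) (t + 1) (Fin.snoc ω p) := by
  rw [numAtLeast, ← card_insert_of_notMem (a := A t ω p) (by simp [hA])]
  refine card_le_card fun b => ?_
  simp only [mem_insert, mem_filter, mem_univ, true_and, loads_snoc]
  rintro (rfl | hb)
  · simp [hA]
  · omega

/-- If all probes inspect bins of load `h`, then the ball goes into one of them. -/
theorem IsFirstDiff.load_eq {A : Rule n k} (hA : IsFirstDiff A) {h t : ℕ} {ω : Fin t → Probes n k}
    {p : Probes n k} (hp : ∀ i, loads A t ω (p i) = h) : loads A t ω (A t ω p) = h := by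
  obtain ⟨j, -, ⟨-, ⟨i, -, hi⟩, -⟩ | ⟨-, hj⟩⟩ := hA t ω p
  · rw [← hi, hp]
  · rw [hj, hp]

theorem card_load_eq (h t : ℕ) (ω : Fin t → Probes n k) :
    #{b | loads A t ω b = h} + numAtLeast A (h + 1) t ω = numAtLeast A h t ω := by
  rw [numAtLeast, numAtLeast, ← card_union_of_disjoint]
  · congr 1
    ext b
    simp only [mem_union, mem_filter, mem_univ, true_and]
    omega
  · rw [disjoint_filter]
    intro b _
    omega

/-- Loads never decrease, so a level count once attained persists. -/
theorem condMean_fewAtLeast_nonpos {h : ℕ} {N : ℝ} (s : ℕ) {t : ℕ} {ω : Fin t → Probes n k}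
    (hN : N ≤ numAtLeast A h t ω) : condMean (fewAtLeast A h N) s t ω ≤ 0 := by
  induction s generalizing t ω with
  | zero => simp [condMean, fewAtLeast, not_lt.2 hN]
  | succ s ih =>
    refine div_nonpos_of_nonpos_of_nonneg (sum_nonpos fun p _ => ih ?_) (by positivity)
    exact hN.trans (by exact_mod_cast numAtLeast_snoc_ge A h t ω p)

theorem card_probes_subset (T : Finset (Fin n)) :
    #{p : Probes n k | ∀ i, p i ∈ T} = #T ^ k := by
  have : ({p : Probes n k | ∀ i, p i ∈ T} : Finset _) = Fintype.piFinset fun _ => T := by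
    ext p
    simp
  rw [this, Fintype.card_piFinset_const]

/-- A Chernoff bound for the number of bins of load at least `h + 1` after `s` more balls. -/
theorem condMean_fewAtLeast_le [NeZero n] {A : Rule n k} (hA : IsFirstDiff A) {h : ℕ} {N N' π : ℝ}
    (hπ : 0 ≤ π) (hπ1 : π ≤ 1) (hNN : π * n ≤ N - N')
    (s : ℕ) {t : ℕ} {ω : Fin t → Probes n k} (hN : N ≤ numAtLeast A h t ω) :
    condMean (fewAtLeast A (h + 1) N') s t ω
      ≤ Real.exp (N' - numAtLeast A (h + 1) t ω) * (1 - π ^ k / 2) ^ s := by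
  have hρ : 0 ≤ 1 - π ^ k / 2 := by linarith [pow_le_one₀ (n := k) hπ hπ1]
  induction s generalizing t ω with
  | zero =>
    simp only [condMean, fewAtLeast, pow_zero, mul_one]
    split_ifs with hlt
    · exact Real.one_le_exp (by linarith)
    · positivity
  | succ s ih =>
    set X := numAtLeast A (h + 1) t ω with hX
    -- Below the target, fewer than N' bins exceed h, so at least N - N' ≥ πn bins have load exactly
    -- h.
    rcases le_or_gt N' X with hle | hlt
    · exact (condMean_fewAtLeast_nonpos A (s + 1) hle).trans (by positivity)
    have hn : (0 : ℝ) < n := by exact_mod_cast NeZero.pos n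
    have hP : (0 : ℝ) < Fintype.card (Probes n k) := by exact_mod_cast Fintype.card_pos
    set T : Finset (Fin n) := {b | loads A t ω b = h} with hT
    set B := Real.exp (N' - X) * (1 - π ^ k / 2) ^ s with hB
    have hB0 : 0 ≤ B := by positivity
    clear_value B
    have hcard : π * n ≤ (#T : ℝ) := by
      have h1 := card_load_eq A h t ω
      have h2 : (#T : ℝ) + X = numAtLeast A h t ω := by exact_mod_cast h1
      linarith
    have hgood : π ^ k * Fintype.card (Probes n k)
        ≤ (#{p : Probes n k | ∀ i, p i ∈ T} : ℝ) := by
      rw [card_probes_subset, Fintype.card_fun, Fintype.card_fin, Fintype.card_fin]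
      push_cast
      rw [← mul_pow]
      gcongr
    -- A ball with all probes at level h raises the count by one, which at least halves the
    -- exponential weight because e ≥ 2.
    have hstep : ∀ p : Probes n k, condMean (fewAtLeast A (h + 1) N') s (t + 1) (Fin.snoc ω p)
        ≤ B - (if ∀ i, p i ∈ T then 1 else 0) * (B / 2) := by
      intro p
      have hmono := numAtLeast_snoc_ge A h t ω p
      refine (ih (hN.trans (by exact_mod_cast hmono))).trans ?_
      split_ifs with hp
      · have hX1 : (X : ℝ) + 1 ≤ numAtLeast A (h + 1) (t + 1) (Fin.snoc ω p) := by
          have := numAtLeast_snoc_of_load_eq A (hA.load_eq (ω := ω) (p := p) (h := h)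
            fun i => by simpa [hT] using hp i)
          exact_mod_cast this
        have hexp : Real.exp (N' - numAtLeast A (h + 1) (t + 1) (Fin.snoc ω p))
            ≤ Real.exp (N' - X) / 2 := by
          have h2 : (2 : ℝ) ≤ Real.exp 1 := by linarith [Real.add_one_le_exp 1]
          calc _ ≤ Real.exp (N' - X - 1) := Real.exp_le_exp.2 (by linarith)
            _ = Real.exp (N' - X) / Real.exp 1 := Real.exp_sub _ _
            _ ≤ _ := by gcongr
        calc _ ≤ Real.exp (N' - X) / 2 * (1 - π ^ k / 2) ^ s := by gcongr
          _ = _ := by rw [hB]; ring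
      · have hX1 : (X : ℝ) ≤ numAtLeast A (h + 1) (t + 1) (Fin.snoc ω p) := by
          exact_mod_cast numAtLeast_snoc_ge A (h + 1) t ω p
        rw [zero_mul, sub_zero, hB]
        gcongr
    calc condMean (fewAtLeast A (h + 1) N') (s + 1) t ω
        ≤ (∑ p : Probes n k, (B - (if ∀ i, p i ∈ T then 1 else 0) * (B / 2))) /
          Fintype.card (Probes n k) := by
          simp only [condMean]
          gcongr with p
          exact hstep p
      _ = (Fintype.card (Probes n k) * B - #{p : Probes n k | ∀ i, p i ∈ T} * (B / 2)) /
          Fintype.card (Probes n k) := by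
          rw [sum_sub_distrib, sum_const, card_univ, nsmul_eq_mul, ← sum_mul, sum_boole]
      _ ≤ (Fintype.card (Probes n k) * B - π ^ k * Fintype.card (Probes n k) * (B / 2)) /
          Fintype.card (Probes n k) := by gcongr
      _ = B * (1 - π ^ k / 2) := by field_simp
      _ = _ := by rw [hB]; ring

/-! ### Layered induction -/

/-- After phase `i` of the layered induction, at least `n / 2 ^ layerExp k j i` bins have reached
the next level, if it starts with `n / 2 ^ (j + 1)` bins. -/
def layerExp (k j : ℕ) : ℕ → ℕ
  | 0 => j + 1
  | i + 1 => k * (layerExp k j i + 1) + i + 4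

/-- The surplus `i + 10` on the left absorbs the additive terms of the recursion, leaving pure
growth by the factor k. -/
theorem layerExp_le (hk : 3 ≤ k) (j i : ℕ) : layerExp k j i + i + 10 ≤ k ^ i * (j + 11) := by
  induction i with
  | zero => simp [layerExp]
  | succ i ih =>
    calc layerExp k j (i + 1) + (i + 1) + 10 = k * (layerExp k j i + 1) + 2 * i + 15 := by
          simp only [layerExp]; ring
      _ ≤ k * (layerExp k j i + i + 10) := by nlinarith
      _ ≤ k * (k ^ i * (j + 11)) := by gcongr
      _ = _ := by ring

theorem layerExp_monotone (hk : 3 ≤ k) (j : ℕ) : Monotone (layerExp k j) := by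
  refine monotone_nat_of_le_succ fun i => ?_
  simp only [layerExp]
  nlinarith

/-- The phase has at least n / 2^(i+2) balls, so the drift s·q/2 is at least twice the target n /
2^e'. The Chernoff exponent is thus at most -n / 2^e' ≤ -√n. -/
theorem condMean_phase_le [NeZero n] {A : Rule n k} (hA : IsFirstDiff A) (hk : 3 ≤ k) {h e i : ℕ}
    (he : 2 * (k * (e + 1) + i + 4) ≤ Nat.log 2 n) {t : ℕ} {ω : Fin t → Probes n k}
    (hN : (n : ℝ) / 2 ^ e ≤ numAtLeast A h t ω) :
    condMean (fewAtLeast A (h + 1) ((n : ℝ) / 2 ^ (k * (e + 1) + i + 4)))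
      (n / 2 ^ i - n / 2 ^ (i + 1)) t ω ≤ Real.exp (-√n) := by
  have hn : (0 : ℝ) < n := by exact_mod_cast NeZero.pos n
  have hpow : ∀ a, a ≤ Nat.log 2 n → (2 : ℝ) ^ a ≤ n := fun a ha => by
    exact_mod_cast (Nat.pow_le_pow_right two_pos ha).trans
      (Nat.pow_log_le_self 2 (NeZero.ne n))
  set e' := k * (e + 1) + i + 4 with he'
  have hee : e + 1 + 1 ≤ e' := by nlinarith
  -- Rounding down costs at most a factor 2, as 2^(i+2) ≤ n.
  have hs : (n : ℝ) / 2 ^ (i + 2) ≤ ((n / 2 ^ i - n / 2 ^ (i + 1) : ℕ) : ℝ) := by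
    have h1 : n / 2 ^ (i + 1) ≤ n / 2 ^ i - n / 2 ^ (i + 1) := by
      rw [pow_succ, ← Nat.div_div_eq_div_mul]
      omega
    refine le_trans ?_ (Nat.cast_le.2 h1)
    have h2 : (n : ℝ) < ((n / 2 ^ (i + 1) : ℕ) + 1) * 2 ^ (i + 1) := by
      exact_mod_cast (Nat.div_lt_iff_lt_mul (by positivity)).1 (Nat.lt_succ_self (n / 2 ^ (i + 1)))
    have h3 := hpow (i + 2) (by omega)
    rw [div_le_iff₀ (by positivity)]
    have : (2 : ℝ) ^ (i + 2) = 2 * 2 ^ (i + 1) := by ring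
    rw [this] at h3 ⊢
    linarith
  have hsqrt : √n ≤ n / 2 ^ e' := by
    rw [le_div_iff₀ (by positivity)]
    have h1 : (2 : ℝ) ^ e' ≤ √n := by
      refine Real.le_sqrt_of_sq_le ?_
      rw [← pow_mul, mul_comm]
      exact hpow _ he
    calc √n * 2 ^ e' ≤ √n * √n := by gcongr
      _ = n := Real.mul_self_sqrt hn.le
  have hπ1 : (1 / 2 : ℝ) ^ (e + 1) ≤ 1 := pow_le_one₀ (by norm_num) (by norm_num)
  have hNN : (1 / 2 : ℝ) ^ (e + 1) * n ≤ n / 2 ^ e - n / 2 ^ e' := by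
    have : (n : ℝ) / 2 ^ e' ≤ n / 2 ^ (e + 1) := by
      gcongr
      · norm_num
      · omega
    have h2 : (n : ℝ) / 2 ^ e = 2 * (n / 2 ^ (e + 1)) := by
      rw [pow_succ]; field_simp
    have h3 : (1 / 2 : ℝ) ^ (e + 1) * n = n / 2 ^ (e + 1) := by
      rw [div_pow, one_pow]; ring
    linarith
  refine (condMean_fewAtLeast_le hA (by positivity) hπ1 hNN _ hN).trans ?_
  set s := n / 2 ^ i - n / 2 ^ (i + 1)
  set q : ℝ := ((1 / 2 : ℝ) ^ (e + 1)) ^ k with hq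
  have hq1 : q ≤ 1 := pow_le_one₀ (by positivity) hπ1
  -- The `+ i + 4` in e' pays for the phase length (i + 2), the halved q and the factor 2 on the
  -- left.
  have hqs : 2 * ((n : ℝ) / 2 ^ e') ≤ s * (q / 2) := by
    calc 2 * ((n : ℝ) / 2 ^ e') = (n : ℝ) / 2 ^ (i + 2) * (q / 2) := by
          have : (2 : ℝ) ^ e' = 2 ^ (i + 2) * 4 * (2 ^ (e + 1)) ^ k := by
            rw [he', ← pow_mul]; ring
          rw [this, hq, div_pow, one_pow, div_pow, one_pow]
          field_simp
          norm_num
      _ ≤ _ := by gcongr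
  calc _ ≤ Real.exp (n / 2 ^ e') * Real.exp (-(q / 2)) ^ s := by
        refine mul_le_mul (Real.exp_le_exp.2 (sub_le_self _ (Nat.cast_nonneg _)))
          (pow_le_pow_left₀ (by linarith) ?_ s) (pow_nonneg (by linarith) s) (Real.exp_nonneg _)
        linarith [Real.add_one_le_exp (-(q / 2))]
    _ = Real.exp (n / 2 ^ e' - s * (q / 2)) := by
        rw [← Real.exp_nat_mul, ← Real.exp_add]; ring_nf
    _ ≤ _ := Real.exp_le_exp.2 (by linarith)

theorem condMean_layers_le [NeZero n] {A : Rule n k} (hA : IsFirstDiff A) (hk : 3 ≤ k)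
    {h j I : ℕ} (hI : 0 < I → 2 * layerExp k j I ≤ Nat.log 2 n) (l i : ℕ) (hl : i + l = I)
    {t : ℕ} {ω : Fin t → Probes n k}
    (hN : (n : ℝ) / 2 ^ layerExp k j i ≤ numAtLeast A (h + i) t ω) :
    condMean (fewAtLeast A (h + I) ((n : ℝ) / 2 ^ layerExp k j I)) (n / 2 ^ i) t ω
      ≤ l * Real.exp (-√n) := by
  induction l generalizing i t ω with
  | zero =>
    obtain rfl : i = I := hl
    simpa using condMean_fewAtLeast_nonpos A _ hN
  | succ l ih =>
    have hle : n / 2 ^ (i + 1) ≤ n / 2 ^ i := Nat.div_le_div_left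
      (Nat.pow_le_pow_right two_pos (Nat.le_succ i)) (by positivity)
    have hexp : 2 * layerExp k j (i + 1) ≤ Nat.log 2 n :=
      (Nat.mul_le_mul_left 2 (layerExp_monotone hk j (by omega))).trans (hI (by omega))
    rw [← Nat.sub_add_cancel hle, condMean_add]
    calc _ ≤ condMean (fun t ω => fewAtLeast A (h + i + 1) ((n : ℝ) / 2 ^ layerExp k j (i + 1)) t ω
            + l * Real.exp (-√n)) (n / 2 ^ i - n / 2 ^ (i + 1)) t ω := by
          refine condMean_mono (fun t ω => ?_) _ _ _
          -- Union bound: a failed phase is charged 1 here and enters the total through its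
          -- probability.
          by_cases hgood : (n : ℝ) / 2 ^ layerExp k j (i + 1) ≤ numAtLeast A (h + (i + 1)) t ω
          · have h0 : fewAtLeast A (h + i + 1) ((n : ℝ) / 2 ^ layerExp k j (i + 1)) t ω = 0 :=
              if_neg (not_lt.2 hgood)
            rw [h0, zero_add]
            exact ih (i + 1) (by omega) hgood
          · have h1 : fewAtLeast A (h + i + 1) ((n : ℝ) / 2 ^ layerExp k j (i + 1)) t ω = 1 :=
              if_pos (not_le.1 hgood)
            rw [h1]
            exact (condMean_le_one (fewAtLeast_le_one A _ _) _ _ _).trans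
              (le_add_of_nonneg_right (by positivity))
      _ ≤ Real.exp (-√n) + l * Real.exp (-√n) := by
          rw [condMean_add_const]
          gcongr
          exact condMean_phase_le hA hk hexp hN
      _ = _ := by push_cast; ring

/-! ### The starting level -/

/-- Some level `j` above the average load is met by a fraction `2 ^ (-j - 1)` of the bins. -/
theorem exists_le_numAtLeast [NeZero n] (t : ℕ) (ω : Fin t → Probes n k) :
    ∃ j, (n : ℝ) / 2 ^ (j + 1) ≤ numAtLeast A (t / n + j) t ω := by
  by_contra! hc
  obtain ⟨q, hq⟩ : ∃ q, q = t / n := ⟨_, rfl⟩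
  have hqt : n * q ≤ t := hq ▸ Nat.mul_div_le t n
  rw [← hq] at hc
  have hn : (0 : ℝ) < n := by exact_mod_cast NeZero.pos n
  -- Truncated subtraction only enlarges the sum; counted by levels it equals the sum of the level
  -- counts, which would be below n if every count were below n / 2^(j+1).
  have hsum : n ≤ ∑ b, (loads A t ω b + 1 - q) := by
    have h1 : ∑ b, (loads A t ω b + 1) ≤ ∑ b, ((loads A t ω b + 1 - q) + q) :=
      sum_le_sum fun b _ => by omega
    rw [sum_add_distrib, sum_add_distrib, sum_loads, sum_const, sum_const, card_univ,
      Fintype.card_fin, smul_eq_mul, smul_eq_mul] at h1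
    omega
  have hcount : ∑ b, (loads A t ω b + 1 - q)
      = ∑ j ∈ range (t + 1), numAtLeast A (q + j) t ω := by
    simp only [numAtLeast, card_filter]
    rw [sum_comm]
    refine sum_congr rfl fun b _ => ?_
    rw [← card_filter]
    have hb : loads A t ω b ≤ t := by
      calc _ ≤ ∑ b, loads A t ω b := single_le_sum (fun _ _ => Nat.zero_le _) (mem_univ b)
        _ = t := sum_loads A t ω
    have : ({j ∈ range (t + 1) | q + j ≤ loads A t ω b} : Finset ℕ)
        = range (loads A t ω b + 1 - q) := by
      ext j
      simp only [mem_filter, mem_range]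
      omega
    rw [this, card_range]
  have hgeom : ∀ M : ℕ, ∑ j ∈ range M, (n : ℝ) / 2 ^ (j + 1) = n - n / 2 ^ M := by
    intro M
    induction M with
    | zero => simp
    | succ M ih => rw [sum_range_succ, ih, pow_succ]; field_simp; ring
  have hlt : ∑ j ∈ range (t + 1), (numAtLeast A (q + j) t ω : ℝ)
      < ∑ j ∈ range (t + 1), (n : ℝ) / 2 ^ (j + 1) :=
    sum_lt_sum_of_nonempty (by simp) fun j _ => hc j
  rw [hgeom] at hlt
  have h1 : (n : ℝ) ≤ ∑ j ∈ range (t + 1), (numAtLeast A (q + j) t ω : ℝ) := by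
    exact_mod_cast hcount ▸ hsum
  have : (0 : ℝ) < n / 2 ^ (t + 1) := by positivity
  linarith

theorem le_maxLoad_of_numAtLeast_pos {A : Rule n k} {h t : ℕ} {ω : Fin t → Probes n k}
    (hpos : 0 < numAtLeast A h t ω) : h ≤ maxLoad A t ω := by
  obtain ⟨b, hb⟩ := card_pos.1 hpos
  exact (mem_filter.1 hb).2.trans (le_sup (f := loads A t ω) (mem_univ b))

/-! ### Counting the layers and conclusion -/

/-- The number `I` of layers that can be climbed from level `j`. -/
theorem exists_layers (hn : 2 ≤ n) (hk : 3 ≤ k) (j : ℕ) :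
    ∃ I : ℕ, (0 < I → 2 * layerExp k j I ≤ Nat.log 2 n) ∧ I ≤ n ∧
      Real.log (Real.log n) / Real.log k ≤ j + I + 12 := by
  set L := Nat.log 2 n with hL
  -- `Nat.log` is 0 if j is too large for any layer to fit; the guard `0 < I` then makes the size
  -- condition vacuous.
  set I := Nat.log k (L / (2 * (j + 11))) with hIdef
  have hpow : 0 < I → k ^ I * (2 * (j + 11)) ≤ L := by
    intro hI
    have h0 : L / (2 * (j + 11)) ≠ 0 := by
      rintro h0
      rw [hIdef, h0, Nat.log_zero_right] at hI
      exact lt_irrefl 0 hI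
    exact (Nat.mul_le_mul_right _ (Nat.pow_log_le_self k h0)).trans (Nat.div_mul_le_self _ _)
  have hLn : L ≤ n := Nat.log_le_self 2 n
  refine ⟨I, fun hI => ?_, ?_, ?_⟩
  · have := layerExp_le hk j I
    have := hpow hI
    nlinarith
  · rcases Nat.eq_zero_or_pos I with h0 | h0
    · omega
    · have h1 : I < k ^ I := Nat.lt_pow_self (by omega)
      have := hpow h0
      nlinarith
  · have hlt : L < 2 * (j + 11) * k ^ (I + 1) := by
      have h1 : L / (2 * (j + 11)) < k ^ (I + 1) := Nat.lt_pow_succ_log_self (by omega) _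
      rw [Nat.div_lt_iff_lt_mul (by omega)] at h1
      linarith
    have hk1 : 1 ≤ Real.log k := by
      rw [Real.le_log_iff_exp_le (by positivity)]
      have : (3 : ℝ) ≤ k := by exact_mod_cast hk
      linarith [Real.exp_one_lt_d9]
    have hlogn : 0 < Real.log n := Real.log_pos (by exact_mod_cast hn)
    have hlog2 : Real.log 2 ≤ 1 := by linarith [Real.log_two_lt_d9]
    have hlog20 : 0 ≤ Real.log 2 := Real.log_nonneg (by norm_num)
    have h1 : Real.log n ≤ 2 * (j + 11) * (k : ℝ) ^ (I + 1) := by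
      have h2 : (n : ℝ) ≤ 2 ^ (L + 1) := by
        exact_mod_cast (Nat.lt_pow_succ_log_self one_lt_two n).le
      have h3 : ((L + 1 : ℕ) : ℝ) ≤ ((2 * (j + 11) * k ^ (I + 1) : ℕ) : ℝ) := by
        exact_mod_cast hlt
      calc Real.log n ≤ Real.log (2 ^ (L + 1)) := Real.log_le_log (by positivity) h2
        _ = ((L + 1 : ℕ) : ℝ) * Real.log 2 := Real.log_pow _ _
        _ ≤ ((L + 1 : ℕ) : ℝ) * 1 := by gcongr
        _ ≤ _ := by rw [mul_one]; refine h3.trans (le_of_eq (by push_cast; ring))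
    have hkpos : (0 : ℝ) < k := by positivity
    have h2 : Real.log (Real.log n)
        ≤ Real.log 2 + Real.log (j + 11) + (I + 1) * Real.log k := by
      refine (Real.log_le_log hlogn h1).trans (le_of_eq ?_)
      rw [Real.log_mul (by positivity) (by positivity), Real.log_mul (by norm_num) (by positivity),
        Real.log_pow]
      push_cast
      ring
    -- The loss from starting at a high level is at most linear in j, hence covered by the j levels
    -- already gained.
    have h3 : Real.log (j + 11) ≤ j + 10 := by
      linarith [Real.log_le_sub_one_of_pos (x := (j : ℝ) + 11) (by positivity)]
    rw [div_le_iff₀ (by linarith)]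
    have : (j : ℝ) + 11 ≤ (j + 11) * Real.log k := le_mul_of_one_le_right (by positivity) hk1
    nlinarith

/-- The fourth Taylor term gives exp(√n) ≥ n² / 24. -/
theorem mul_exp_neg_sqrt_le (hn : 0 < n) : (n : ℝ) * Real.exp (-√n) ≤ 24 * (n : ℝ) ^ (-1 : ℝ) := by
  have hn' : (0 : ℝ) < n := by exact_mod_cast hn
  have h1 := Real.pow_div_factorial_le_exp (√n) (Real.sqrt_nonneg _) 4
  have h2 : √(n : ℝ) ^ 4 = n ^ 2 := by
    rw [show 4 = 2 * 2 from rfl, pow_mul, Real.sq_sqrt hn'.le]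
  rw [h2, show ((Nat.factorial 4 : ℕ) : ℝ) = 24 by norm_num [Nat.factorial]] at h1
  rw [Real.exp_neg, Real.rpow_neg_one, ← div_eq_mul_inv, ← div_eq_mul_inv,
    div_le_div_iff₀ (Real.exp_pos _) hn']
  rw [div_le_iff₀ (by norm_num)] at h1
  nlinarith

theorem mean_maxLoad_lt_le (hn : 2 ≤ n) (hk : 3 ≤ k) {A : Rule n k} (hA : IsFirstDiff A) (t : ℕ)
    {x : ℝ} (hx : x ≤ t / n + Real.log (Real.log n) / Real.log k - 13) :
    mean (fun s ω => if (maxLoad A s ω : ℝ) < x then 1 else 0) (t + n)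
      ≤ n * Real.exp (-√n) := by
  have : NeZero n := ⟨by omega⟩
  have hn0 : (0 : ℝ) < n := by exact_mod_cast NeZero.pos n
  -- The bound is uniform over the first t balls, although j and I depend on them.
  rw [mean_add]
  refine mean_le fun ω => ?_
  obtain ⟨j, hj⟩ := exists_le_numAtLeast A t ω
  obtain ⟨I, hI, hIn, hlog⟩ := exists_layers hn hk j
  have hq : (t : ℝ) / n ≤ (t / n : ℕ) + 1 := by
    rw [div_le_iff₀ hn0]
    exact_mod_cast ((Nat.div_lt_iff_lt_mul (NeZero.pos n)).1 (Nat.lt_succ_self (t / n))).le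
  have hlayers := condMean_layers_le hA hk (h := t / n + j) hI I 0 (zero_add I) hj
  rw [pow_zero, Nat.div_one] at hlayers
  calc _ ≤ condMean (fewAtLeast A (t / n + j + I) ((n : ℝ) / 2 ^ layerExp k j I)) n t ω := by
        refine condMean_mono (fun s ω => ?_) _ _ _
        simp only [fewAtLeast]
        split_ifs with h1 h2 h2
        · exact le_rfl
        · exfalso
          have hpos : (0 : ℝ) < n / 2 ^ layerExp k j I := by positivity
          have hmax : t / n + j + I ≤ maxLoad A s ω := le_maxLoad_of_numAtLeast_pos
            (by exact_mod_cast hpos.trans_le (not_lt.1 h2))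
          have : ((t / n : ℕ) : ℝ) + j + I ≤ maxLoad A s ω := by exact_mod_cast hmax
          linarith
        · exact zero_le_one
        · exact le_rfl
    _ ≤ I * Real.exp (-√n) := hlayers
    _ ≤ _ := by gcongr

end BallsBins

theorem theorem4 :
    ∃ C K r : ℝ, 0 < C ∧ 0 < K ∧ 0 < r ∧
      ∀ c₁ c₂ : ℝ, 0 < c₁ → 0 < c₂ →
        ∃ a b : ℝ, 0 < a ∧ 0 < b ∧
          ∀ (d : ℝ) (k : ℕ), 2 < k →
            (2 : ℝ) ^ (c₁ * d) ≤ (k : ℝ) → (k : ℝ) ≤ (2 : ℝ) ^ (c₂ * d) →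
            (a * d ≤ Real.log k ∧ Real.log k ≤ b * d) ∧
            ∀ (n m : ℕ), 2 ≤ n → n ≤ m →
              ∀ A : BallsBins.Rule n k, BallsBins.IsFirstDiff A →
                1 - K * (n : ℝ) ^ (-r) ≤
                  (BallsBins.probeLaw n k m).real
                    {ω | (m : ℝ) / n + Real.log (Real.log n) / Real.log k - C ≤
                      (BallsBins.maxLoad A m ω : ℝ)} := by
  -- 14 = 12 from the layer count, 1 for rounding t / n down, and 1 for the n balls held back.
  refine ⟨14, 24, 1, by norm_num, by norm_num, by norm_num, fun c₁ c₂ h₁ h₂ => ?_⟩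
  have hlog2 : 0 < Real.log 2 := Real.log_pos one_lt_two
  refine ⟨c₁ * Real.log 2, c₂ * Real.log 2, by positivity, by positivity,
    fun d k hk hk₁ hk₂ => ⟨⟨?_, ?_⟩, ?_⟩⟩
  · have := Real.log_le_log (by positivity) hk₁
    rw [Real.log_rpow two_pos] at this
    linarith
  · have := Real.log_le_log (by positivity) hk₂
    rw [Real.log_rpow two_pos] at this
    linarith
  · intro n m hn hnm A hA
    obtain ⟨t, rfl⟩ := Nat.exists_eq_add_of_le' hnm
    have : NeZero n := ⟨by omega⟩
    have hn0 : (0 : ℝ) < n := by exact_mod_cast NeZero.pos n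
    set x := ((t + n : ℕ) : ℝ) / n + Real.log (Real.log n) / Real.log k - 14 with hxdef
    have hx : x ≤ t / n + Real.log (Real.log n) / Real.log k - 13 := by
      rw [hxdef, Nat.cast_add, add_div, div_self hn0.ne']
      linarith
    have hfail := (BallsBins.mean_maxLoad_lt_le hn hk hA t hx).trans
      (BallsBins.mul_exp_neg_sqrt_le (by omega))
    have hcompl := BallsBins.probeLaw_real_add_mean A (t + n) x
    linarith
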